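/- Let $S=\mathbb{C}[x,y,z]$ and let $\mathcal{A}$ be an arrangement of $d\ge 1$ distinct lines in the complex projective plane $\mathbb{P}^2$, with equation $f=0$, where $f\in S$ is the product of linear forms defining the lines. Let $D_0(\mathcal{A})=\{(a,b,c)\in S^3 : a f_x+b f_y+c f_z=0\}$ be the graded $S$-module of Jacobian syzygies of $f$, and let $d_1\le d_2\le\dots\le d_k$ be the exponents of $\mathcal{A}$, that is, the degrees of a minimal system of homogeneous generators of $D_0(\mathcal{A})$. The arrangement is called free if $D_0(\mathcal{A})$ is a free $S$-module. The multiplicity of a point of $\mathcal{A}$ (a point lying on at least one of the lines) is the number of lines of $\mathcal{A}$ through it. Let $m(\mathcal{A})$ be the maximal multiplicity of a point of $\mathcal{A}$, let $p$ be any point of multiplicity $m(\mathcal{A})$, and let $n(\mathcal{A})$ be the maximal multiplicity of a point of $\mathcal{A}$ other than $p$. Then $k\ge 2$, and with $t(\mathcal{A})=d_1+d_2-d+1$ one has $t(\mathcal{A})\ge 0$ and $$m(\mathcal{A})-1\le t(\mathcal{A})+m(\mathcal{A})-1\le d_2\le d-n(\mathcal{A}).$$ In particular, the equality $d_2=m(\mathcal{A})-1$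 implies that $\mathcal{A}$ is free and $d_1=d-m(\mathcal{A})$, and if $\mathcal{A}$ is not free then $m(\mathcal{A})\le d_2$. Moreover $$0\le t(\mathcal{A})\le d+1-m(\mathcal{A})-n(\mathcal{A}).$$ -/

import Mathlib

open MvPolynomial
open scoped LinearAlgebra.Projectivization

namespace PlaneArrangement

/-- The complex projective plane. -/
abbrev Plane : Type := ℙ ℂ (Fin 3 → ℂ)

/-- The polynomial ring `S = ℂ[x, y, z]`. -/
abbrev S : Type := MvPolynomial (Fin 3) ℂ

/-- A line `a x + b y + c z = 0` of the projective plane, given by its class `(a : b : c)`. -/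
abbrev Line : Type := ℙ ℂ (Fin 3 → ℂ)

/-- An arrangement of `d` lines is a set of `d` distinct lines. -/
abbrev Arrangement : Type := Finset Line

/-- The point `p` lies on the line `L`: if `L = (a : b : c)` and `p = (x : y : z)`, then
`a x + b y + c z = 0`. -/
def Line.Through (L : Line) (p : Plane) : Prop :=
  Projectivization.orthogonal L p

/-- A linear form which defines the line `L` (well defined up to a nonzero scalar). -/
noncomputable def Line.form (L : Line) : S :=
  ∑ i, C (L.rep i) * X i

namespace Arrangement

/-- The equation `f = 0` of the arrangement: the product of the linear forms of its lines
(well defined up to a nonzero scalar). -/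
noncomputable def equation (A : Arrangement) : S :=
  ∏ L ∈ A, Line.form L

open scoped Classical in
/-- The multiplicity of the arrangement at `p`: the number of its lines through `p`. -/
noncomputable def mult (A : Arrangement) (p : Plane) : ℕ :=
  (A.filter fun L => Line.Through L p).card

/-- The set of points of the arrangement: the union of its lines. -/
def points (A : Arrangement) : Set Plane :=
  {p | ∃ L ∈ A, Line.Through L p}

/-- `m` is the maximal multiplicity of a point of `A`. -/
def IsMaxMult (A : Arrangement) (m : ℕ) : Prop :=
  IsGreatest (A.mult '' A.points) m

/-- `n` is the maximal multiplicity of a point of `A` other than `p`. -/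
def IsMaxMultAway (A : Arrangement) (p : Plane) (n : ℕ) : Prop :=
  IsGreatest (A.mult '' (A.points \ {p})) n

end Arrangement

/-- The `S`-module of Jacobian syzygies `D₀(f)`: the triples `ρ = (a, b, c)` in `S³` with
`a f_x + b f_y + c f_z = 0`. -/
noncomputable def D0 (f : S) : Submodule S (Fin 3 → S) where
  carrier := {ρ | ∑ i, ρ i * pderiv i f = 0}
  zero_mem' := by simp
  add_mem' := by
    intro a b ha hb
    simp only [Set.mem_ofPred_eq] at ha hb ⊢
    simp only [Pi.add_apply, add_mul, Finset.sum_add_distrib, ha, hb, add_zero]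
  smul_mem' := by
    intro c a ha
    simp only [Set.mem_ofPred_eq] at ha ⊢
    simp only [Pi.smul_apply, smul_eq_mul, mul_assoc, ← Finset.mul_sum, ha, mul_zero]

/-- The triple `ρ` is homogeneous of degree `e`. -/
def IsHomogeneousTriple (ρ : Fin 3 → S) (e : ℕ) : Prop :=
  ∀ i, (ρ i).IsHomogeneous e

/-- `ρ₁, …, ρₖ` is a minimal system of generators of the module `N`: it generates `N`, and
no `ρⱼ` is in the submodule generated by the others. -/
def IsMinimalGenerators (N : Submodule S (Fin 3 → S)) {k : ℕ} (ρ : Fin k → Fin 3 → S) : Prop :=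
  Submodule.span S (Set.range ρ) = N ∧ ∀ j, ρ j ∉ Submodule.span S (ρ '' {j}ᶜ)

namespace Arrangement

/-- `e₁ ≤ … ≤ eₖ` are the exponents of `A`: the ordered degrees of a minimal system of
homogeneous generators of `D₀(A)`. -/
def IsExponents (A : Arrangement) {k : ℕ} (e : Fin k → ℕ) : Prop :=
  Monotone e ∧ ∃ ρ : Fin k → Fin 3 → S,
    IsMinimalGenerators (D0 A.equation) ρ ∧ ∀ j, IsHomogeneousTriple (ρ j) (e j)

/-- `A` is free if `D₀(A)` is a free `S`-module. -/
def IsFree (A : Arrangement) : Prop :=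
  Module.Free S (D0 A.equation)

lemma equation_isHomogeneous (A : Arrangement) : A.equation.IsHomogeneous A.card := by
  have h := IsHomogeneous.prod A Line.form (fun _ => 1) (fun L _ => by
    refine IsHomogeneous.sum _ _ _ fun i _ => ?_
    simpa using (isHomogeneous_C (Fin 3) (L.rep i)).mul (isHomogeneous_X ℂ i))
  simpa [equation] using h

lemma homogeneousComponent_mul_of_mem (a : S) {b : S} {j : ℕ}
    (hb : b ∈ homogeneousSubmodule (Fin 3) ℂ j) (n : ℕ) :
    homogeneousComponent (n + j) (a * b) = homogeneousComponent n a * b := by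
  let _ : GradedAlgebra (homogeneousSubmodule (Fin 3) ℂ) := MvPolynomial.gradedAlgebra
  have h := DirectSum.coe_decompose_mul_add_of_right_mem
      (homogeneousSubmodule (Fin 3) ℂ) (a := a) (i := n) hb
  rw [← decomposition.decompose'_apply, ← decomposition.decompose'_apply]
  exact h

/-- Every arrangement has exponents. -/
theorem exists_isExponents (A : Arrangement) : ∃ (k : ℕ) (e : Fin k → ℕ), A.IsExponents e := by
  classical
  set f := A.equation
  -- homogeneous components of syzygies are syzygies
  have hcomp : ∀ ρ ∈ D0 f, ∀ n, (fun i => homogeneousComponent n (ρ i)) ∈ D0 f := by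
    intro ρ hρ n
    have hρ' : ∑ i, ρ i * pderiv i f = 0 := hρ
    have h := congrArg (homogeneousComponent (n + (A.card - 1))) hρ'
    rw [map_sum, map_zero] at h
    change ∑ i, homogeneousComponent n (ρ i) * pderiv i f = 0
    rw [← h]
    refine Finset.sum_congr rfl fun i _ => ?_
    have hp : pderiv i f ∈ homogeneousSubmodule (Fin 3) ℂ (A.card - 1) :=
      (equation_isHomogeneous A).pderiv
    exact (homogeneousComponent_mul_of_mem _ hp n).symm
  -- a finite homogeneous generating set exists
  have hex : ∃ c, ∃ T : Finset (Fin 3 → S), T.card = c ∧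
      Submodule.span S (T : Set (Fin 3 → S)) = D0 f ∧ ∀ t ∈ T, ∃ n, IsHomogeneousTriple t n := by
    obtain ⟨T, hT⟩ := IsNoetherian.noetherian (D0 f)
    let N := T.sup fun ρ => Finset.univ.sup fun i => (ρ i).totalDegree + 1
    let T' : Finset (Fin 3 → S) :=
      T.biUnion fun ρ => (Finset.range N).image fun n i => homogeneousComponent n (ρ i)
    refine ⟨_, T', rfl, le_antisymm ?_ ?_, ?_⟩
    · rw [Submodule.span_le]
      intro t ht
      simp only [T', Finset.coe_biUnion, Set.mem_iUnion, Finset.mem_coe, Finset.mem_image] at ht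
      obtain ⟨ρ, hρ, n, _, rfl⟩ := ht
      exact hcomp ρ (hT ▸ Submodule.subset_span hρ) n
    · rw [← hT, Submodule.span_le]
      intro ρ hρ
      have : ρ = ∑ n ∈ Finset.range N, fun i => homogeneousComponent n (ρ i) := by
        funext i
        rw [Finset.sum_apply]
        have hle : (ρ i).totalDegree + 1 ≤ N :=
          (Finset.le_sup (f := fun i => (ρ i).totalDegree + 1) (Finset.mem_univ i)).trans
            (Finset.le_sup (f := fun ρ : Fin 3 → S =>
              Finset.univ.sup fun i => (ρ i).totalDegree + 1) hρ)
        conv_lhs => rw [← sum_homogeneousComponent (ρ i)]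
        refine Finset.sum_subset (Finset.range_mono hle) fun n _ hn => ?_
        exact homogeneousComponent_eq_zero _ _ (by simpa using hn)
      rw [SetLike.mem_coe, this]
      refine Submodule.sum_mem _ fun n hn => Submodule.subset_span ?_
      simp only [T', Finset.mem_coe, Finset.mem_biUnion, Finset.mem_image]
      exact ⟨ρ, hρ, n, hn, rfl⟩
    · intro t ht
      simp only [T', Finset.mem_biUnion, Finset.mem_image] at ht
      obtain ⟨ρ, _, n, _, rfl⟩ := ht
      exact ⟨n, fun i => homogeneousComponent_isHomogeneous _ _⟩
  -- one of minimal cardinality is irredundant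
  obtain ⟨T, hTc, hTs, hTh⟩ := Nat.find_spec hex
  have hmin : ∀ t ∈ T, t ∉ Submodule.span S ((T : Set (Fin 3 → S)) \ {t}) := by
    intro t ht hmem
    have hlt : (T.erase t).card < Nat.find hex := hTc ▸ Finset.card_erase_lt_of_mem ht
    refine Nat.find_min hex hlt ⟨T.erase t, rfl, ?_, fun s hs => hTh s (Finset.mem_of_mem_erase hs)⟩
    rw [← hTs, Finset.coe_erase]
    refine le_antisymm (Submodule.span_mono Set.sdiff_subset) (Submodule.span_le.2 fun s hs => ?_)
    by_cases hst : s = t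
    · exact hst ▸ hmem
    · exact Submodule.subset_span ⟨hs, hst⟩
  choose! g hg using hTh
  let ρ₀ : Fin T.card → Fin 3 → S := fun j => (T.equivFin.symm j : Fin 3 → S)
  let σ := Tuple.sort (g ∘ ρ₀)
  have hinj : Function.Injective (ρ₀ ∘ σ) :=
    (Subtype.val_injective.comp T.equivFin.symm.injective).comp σ.injective
  have hrange : Set.range (ρ₀ ∘ σ) = T := by
    rw [σ.surjective.range_comp]
    change Set.range (Subtype.val ∘ T.equivFin.symm) = _
    rw [T.equivFin.symm.surjective.range_comp]
    simp
  refine ⟨T.card, (g ∘ ρ₀) ∘ σ, Tuple.monotone_sort _, ρ₀ ∘ σ, ⟨?_, fun j => ?_⟩, fun j => ?_⟩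
  · rw [hrange, hTs]
  · rw [Set.image_compl_eq_range_sdiff_image hinj, hrange, Set.image_singleton]
    exact hmin _ (T.equivFin.symm (σ j)).2
  · exact hg _ (T.equivFin.symm (σ j)).2

end Arrangement

end PlaneArrangement

namespace PlaneArrangement

/-! A point r of multiplicity μ gives a syzygy of degree d - μ: write f = g·h with g the product of
the lines through r. Since the derivative ∂_r kills g, Euler's formula makes d·h·r - (∂_r h)·(x,y,z)
a syzygy (`pointSyzygy_mem`). Distinct points give independent syzygies (`pointSyzygy_independent`).
Applied to p and to a point of multiplicity n, this yields k ≥ 2, d₁ ≤ d - m and d₂ ≤ d - n.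

Conversely, the cross product of the first two generators is nonzero
(`cross_ne_zero_of_isMinimalGenerators`) and parallel to the gradient. The gradient is primitive
because f is reduced, so the product is h·∇f for a polynomial h (a new h), and comparing degrees
gives t = deg h ≥ 0. If d₂ = m - 1, then d₁ ≤ d - m forces h to be constant, and Saito's criterion
(`isFree_of_cross_eq`) gives freeness. The remaining inequalities are arithmetic. -/

/-! ### Cross products and proportional vectors. -/

open Matrix in
lemma cross_mul_comm_of_dot_eq_zero {R : Type*} [CommRing R] {v w g : Fin 3 → R}
    (hv : ∑ i, v i * g i = 0) (hw : ∑ i, w i * g i = 0) (i j : Fin 3) :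
    (v ⨯₃ w) i * g j = (v ⨯₃ w) j * g i := by
  rw [Fin.sum_univ_three] at hv hw
  fin_cases i <;> fin_cases j <;> simp [cross_apply]
  · linear_combination w 2 * hv - v 2 * hw
  · linear_combination v 1 * hw - w 1 * hv
  · linear_combination v 2 * hw - w 2 * hv
  · linear_combination w 0 * hv - v 0 * hw
  · linear_combination w 1 * hv - v 1 * hw
  · linear_combination v 0 * hw - w 0 * hv

open Matrix in
lemma mul_comm_of_cross_eq_zero {R : Type*} [CommRing R] {v w : Fin 3 → R}
    (h : v ⨯₃ w = 0) (i j : Fin 3) : v i * w j = v j * w i := by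
  have h0 := congrFun h 0
  have h1 := congrFun h 1
  have h2 := congrFun h 2
  simp [cross_apply] at h0 h1 h2
  fin_cases i <;> fin_cases j <;> simp
  · linear_combination h2
  · linear_combination -h1
  · linear_combination -h2
  · linear_combination h0
  · linear_combination h1
  · linear_combination -h0

-- A nonzero u parallel to both v and w would make v and w parallel to each other.
open Matrix in
lemma eq_zero_of_cross_eq_zero {R : Type*} [CommRing R] [IsDomain R] {u v w : Fin 3 → R}
    (hvw : v ⨯₃ w ≠ 0) (hv : u ⨯₃ v = 0) (hw : u ⨯₃ w = 0) : u = 0 := by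
  have h1 := mul_comm_of_cross_eq_zero hv
  have h2 := mul_comm_of_cross_eq_zero hw
  by_contra hu
  obtain ⟨i, hi⟩ := Function.ne_iff.1 hu
  refine hvw ?_
  have key : ∀ j l, v j * w l - v l * w j = 0 := fun j l => by
    refine (mul_eq_zero.1 ?_).resolve_left hi
    linear_combination w l * h1 i j + v i * h2 j l - w j * h1 i l
  funext l
  fin_cases l <;> simp [cross_apply, key]

/-- Over a factorial domain, proportional vectors are multiples of a common vector. -/
lemma exists_common_factor {R ι : Type*} [CommRing R] [IsDomain R] [UniqueFactorizationMonoid R]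
    {v w : ι → R} (hw : w ≠ 0) (h : ∀ i j, v i * w j = v j * w i) :
    ∃ (a b : R) (u : ι → R), b ≠ 0 ∧ v = a • u ∧ w = b • u := by
  obtain ⟨j, hj⟩ := Function.ne_iff.1 hw
  obtain ⟨a, b, c, hab, ha, hb⟩ :=
    UniqueFactorizationMonoid.exists_reduced_factors' (v j) (w j) hj
  have hc : c ≠ 0 := by rintro rfl; exact hj (by simp [← hb])
  have hb0 : b ≠ 0 := by rintro rfl; exact hj (by simp [← hb])
  have key : ∀ i, v i * b = a * w i := fun i => by
    refine mul_left_cancel₀ hc ?_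
    linear_combination h i j + v i * hb - w i * ha
  have hdvd : ∀ i, b ∣ w i := fun i =>
    hab.symm.dvd_of_dvd_mul_left ⟨v i, by rw [← key i, mul_comm]⟩
  choose u hu using hdvd
  refine ⟨a, b, u, hb0, ?_, funext hu⟩
  funext i
  refine mul_right_cancel₀ hb0 ?_
  rw [key i, hu i, Pi.smul_apply, smul_eq_mul]
  ring

/-- A vector proportional to a primitive one is a multiple of it. -/
lemma exists_smul_of_primitive {R ι : Type*} [CommRing R] [IsDomain R]
    [UniqueFactorizationMonoid R] {v w : ι → R} (hw : w ≠ 0)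
    (hprim : ∀ g : R, Irreducible g → ∃ i, ¬ g ∣ w i) (h : ∀ i j, v i * w j = v j * w i) :
    ∃ a : R, v = a • w := by
  obtain ⟨a, b, u, hb, rfl, rfl⟩ := exists_common_factor hw h
  have hu : IsUnit b := by
    by_contra hbu
    obtain ⟨g, hg, hgb⟩ := WfDvdMonoid.exists_irreducible_factor hbu hb
    obtain ⟨i, hi⟩ := hprim g hg
    exact hi (hgb.mul_right _)
  obtain ⟨c, rfl⟩ := hu
  refine ⟨a * ↑c⁻¹, ?_⟩
  rw [smul_smul, mul_assoc, Units.inv_mul, mul_one]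

/-! ### Homogeneous components and minimal generators. -/

section Graded

/-- The homogeneous component of a triple. -/
noncomputable def tripleComponent (r : ℕ) : (Fin 3 → S) →ₗ[ℂ] (Fin 3 → S) :=
  LinearMap.pi fun i => homogeneousComponent r ∘ₗ LinearMap.proj i

lemma tripleComponent_apply (r : ℕ) (σ : Fin 3 → S) (i : Fin 3) :
    tripleComponent r σ i = homogeneousComponent r (σ i) := rfl

lemma tripleComponent_of_isHomogeneousTriple {σ : Fin 3 → S} {r : ℕ}
    (h : IsHomogeneousTriple σ r) : tripleComponent r σ = σ := by
  funext i
  rw [tripleComponent_apply, homogeneousComponent_of_mem (h i), if_pos rfl]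

lemma homogeneousComponent_mul_of_lt (a : S) {b : S} {j n : ℕ} (hb : b.IsHomogeneous j)
    (h : n < j) : homogeneousComponent n (a * b) = 0 := by
  let _ : GradedAlgebra (homogeneousSubmodule (Fin 3) ℂ) := MvPolynomial.gradedAlgebra
  have h := DirectSum.coe_decompose_mul_of_right_mem_of_not_le
      (homogeneousSubmodule (Fin 3) ℂ) (a := a) (n := n) hb h.not_ge
  rw [← decomposition.decompose'_apply]
  exact h

/-- Taking the degree r part of a combination only changes the coefficients, and generators of
degree above r drop out. -/
lemma tripleComponent_mem_span {k : ℕ} {ρ : Fin k → Fin 3 → S} {e : Fin k → ℕ}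
    (hρ : ∀ j, IsHomogeneousTriple (ρ j) (e j)) {σ : Fin 3 → S}
    (hσ : σ ∈ Submodule.span S (Set.range ρ)) (r : ℕ) :
    tripleComponent r σ ∈ Submodule.span S (ρ '' {j | e j ≤ r}) := by
  obtain ⟨c, rfl⟩ := (Submodule.mem_span_range_iff_exists_fun S).1 hσ
  rw [map_sum]
  refine Submodule.sum_mem _ fun j _ => ?_
  rcases lt_or_ge r (e j) with hlt | hle
  · convert Submodule.zero_mem _
    funext i
    exact homogeneousComponent_mul_of_lt _ (hρ j i) hlt
  · have : tripleComponent r (c j • ρ j) = homogeneousComponent (r - e j) (c j) • ρ j := by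
      funext i
      have := Arrangement.homogeneousComponent_mul_of_mem (c j) (hρ j i) (r - e j)
      rwa [Nat.sub_add_cancel hle] at this
    rw [this]
    exact Submodule.smul_mem _ _ (Submodule.subset_span ⟨j, hle, rfl⟩)

lemma mem_span_of_isHomogeneousTriple {k : ℕ} {ρ : Fin k → Fin 3 → S} {e : Fin k → ℕ}
    (hρ : ∀ j, IsHomogeneousTriple (ρ j) (e j)) {σ : Fin 3 → S} {r : ℕ}
    (hσ : σ ∈ Submodule.span S (Set.range ρ)) (hr : IsHomogeneousTriple σ r) :
    σ ∈ Submodule.span S (ρ '' {j | e j ≤ r}) := by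
  rw [← tripleComponent_of_isHomogeneousTriple hr]
  exact tripleComponent_mem_span hρ hσ r

lemma le_totalDegree_of_mem_span {k : ℕ} {ρ : Fin k → Fin 3 → S} {e : Fin k → ℕ}
    (hρ : ∀ j, IsHomogeneousTriple (ρ j) (e j)) {σ : Fin 3 → S}
    (hσ : σ ∈ Submodule.span S (Set.range ρ)) {r : ℕ} (hr : ∀ j, r ≤ e j)
    {i : Fin 3} (hi : σ i ≠ 0) : r ≤ (σ i).totalDegree := by
  by_contra! hlt
  refine hi ?_
  rw [← sum_homogeneousComponent (σ i)]
  refine Finset.sum_eq_zero fun s hs => ?_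
  have h := tripleComponent_mem_span hρ hσ s
  have hempty : {j | e j ≤ s} = ∅ := by
    ext j
    have := hr j
    simp only [Finset.mem_range] at hs
    simp only [Set.mem_ofPred_eq, Set.mem_empty_iff_false, iff_false]
    omega
  rw [hempty, Set.image_empty, Submodule.span_empty, Submodule.mem_bot] at h
  exact congrFun h i

open Matrix in
/-- A minimal generator of least degree and another minimal generator are independent. -/
lemma cross_ne_zero_of_isMinimalGenerators {N : Submodule S (Fin 3 → S)} {k : ℕ}
    {ρ : Fin k → Fin 3 → S} {e : Fin k → ℕ} (hsat : ∀ (b : S) (u : Fin 3 → S), b ≠ 0 →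
      b • u ∈ N → u ∈ N) (hmin : IsMinimalGenerators N ρ)
    (hρ : ∀ j, IsHomogeneousTriple (ρ j) (e j)) {i j : Fin k} (hij : i ≠ j)
    (hi : ∀ l, e i ≤ e l) : ρ i ⨯₃ ρ j ≠ 0 := by
  intro h
  have hne : ρ i ≠ 0 := fun h0 => hmin.2 i (h0 ▸ Submodule.zero_mem _)
  obtain ⟨a, b, u, hb, hj', hi'⟩ := exists_common_factor (v := ρ j) hne fun l s => by
    linear_combination mul_comm_of_cross_eq_zero h s l
  -- Saturation puts the common direction u in N. Minimality of `e i` then forces b to be constant,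
  -- so `ρ j` is a redundant multiple of `ρ i`.
  have huN : u ∈ N := hsat b u hb (hi' ▸ hmin.1 ▸ Submodule.subset_span ⟨i, rfl⟩)
  obtain ⟨l, hl⟩ := Function.ne_iff.1 hne
  have hl' : ρ i l = b * u l := congrFun hi' l
  have hul : u l ≠ 0 := by intro h0; exact hl (by simp [hl', h0])
  have hdeg := (hρ i l).totalDegree hl
  rw [hl', totalDegree_mul_of_isDomain hb hul] at hdeg
  have := le_totalDegree_of_mem_span hρ (hmin.1.symm ▸ huN) hi hul
  obtain ⟨c, rfl⟩ : ∃ c, b = C c := ⟨_, totalDegree_eq_zero_iff_eq_C.1 (by omega)⟩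
  have hc : c ≠ 0 := by rintro rfl; simp at hb
  refine hmin.2 j (Submodule.mem_span.2 fun P hP => ?_)
  have : ρ j = (a * C c⁻¹) • ρ i := by
    rw [hj', hi', smul_smul, mul_assoc, ← C_mul, inv_mul_cancel₀ hc, C_1, mul_one]
  rw [this]
  exact P.smul_mem _ (hP ⟨i, hij, rfl⟩)

end Graded

lemma mem_D0 {f : S} {ρ : Fin 3 → S} : ρ ∈ D0 f ↔ ∑ i, ρ i * pderiv i f = 0 := Iff.rfl

lemma mem_D0_of_smul_mem {f b : S} {u : Fin 3 → S} (hb : b ≠ 0) (h : b • u ∈ D0 f) :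
    u ∈ D0 f := by
  rw [mem_D0] at h ⊢
  simp only [Pi.smul_apply, smul_eq_mul, mul_assoc, ← Finset.mul_sum] at h
  exact (mul_eq_zero.1 h).resolve_left hb

/-! ### Linear forms of lines. -/

section LinearForms

lemma coeff_form (L : Line) (i : Fin 3) : coeff (Finsupp.single i 1) (Line.form L) = L.rep i := by
  simp [Line.form, coeff_sum, coeff_C_mul, coeff_X, Finsupp.single_left_inj]

lemma form_ne_zero (L : Line) : Line.form L ≠ 0 := by
  intro h
  refine L.rep_nonzero (funext fun i => ?_)
  rw [← coeff_form, h, coeff_zero, Pi.zero_apply]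

lemma form_isHomogeneous (L : Line) : (Line.form L).IsHomogeneous 1 :=
  IsHomogeneous.sum _ _ _ fun i _ => by
    simpa using (isHomogeneous_C (Fin 3) (L.rep i)).mul (isHomogeneous_X ℂ i)

lemma pderiv_form (L : Line) (i : Fin 3) : pderiv i (Line.form L) = C (L.rep i) := by
  simp [Line.form, map_sum, pderiv_X, Pi.single_apply]

lemma form_irreducible (L : Line) : Irreducible (Line.form L) := by
  have hdeg := (form_isHomogeneous L).totalDegree (form_ne_zero L)
  refine irreducible_of_totalDegree_eq_one hdeg fun c hc => ?_
  obtain ⟨i, hi⟩ := Function.ne_iff.1 L.rep_nonzero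
  have := hc (Finsupp.single i 1)
  rw [coeff_form] at this
  exact isUnit_iff_ne_zero.2 (ne_zero_of_dvd_ne_zero hi this)

lemma eq_of_form_dvd_form {L M : Line} (h : Line.form L ∣ Line.form M) : L = M := by
  obtain ⟨u, hu⟩ := h
  have hu0 : u ≠ 0 := by rintro rfl; exact form_ne_zero M (by simpa using hu)
  have hdeg := congrArg totalDegree hu
  rw [totalDegree_mul_of_isDomain (form_ne_zero L) hu0,
    (form_isHomogeneous L).totalDegree (form_ne_zero L),
    (form_isHomogeneous M).totalDegree (form_ne_zero M)] at hdeg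
  obtain ⟨c, rfl⟩ : ∃ c, u = C c := ⟨_, totalDegree_eq_zero_iff_eq_C.1 (by omega)⟩
  rw [← L.mk_rep, ← M.mk_rep, eq_comm, Projectivization.mk_eq_mk_iff']
  refine ⟨c, funext fun i => ?_⟩
  rw [Pi.smul_apply, smul_eq_mul, ← coeff_form, ← coeff_form, hu, mul_comm (Line.form L),
    coeff_C_mul]

end LinearForms

lemma through_iff (L : Line) (p : Plane) : Line.Through L p ↔ ∑ i, p.rep i * L.rep i = 0 := by
  have h := Projectivization.orthogonal_mk L.rep_nonzero p.rep_nonzero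
  rw [L.mk_rep, p.mk_rep] at h
  rw [Line.Through, h, dotProduct]
  simp only [mul_comm]

/-! ### Primitivity of the gradient and Saito's criterion. -/

namespace Arrangement

variable (A : Arrangement)

/-- The partial derivatives of the equation have no common factor. -/
lemma exists_not_dvd_pderiv_equation (hA : A.Nonempty) {g : S} (hg : Irreducible g) :
    ∃ i, ¬ g ∣ pderiv i A.equation := by
  classical
  by_contra! h
  -- Euler's formula, with d invertible in ℂ.
  have hf : g ∣ A.equation := by
    have he := A.equation_isHomogeneous.sum_X_mul_pderiv
    have h1 : g ∣ ∑ i, X i * pderiv i A.equation :=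
      Finset.dvd_sum fun i _ => (h i).mul_left _
    rw [he, ← Nat.cast_smul_eq_nsmul ℂ] at h1
    have h2 := dvd_smul_of_dvd ((A.card : ℂ)⁻¹) h1
    rwa [smul_smul, inv_mul_cancel₀ (by exact_mod_cast hA.card_pos.ne'), one_smul] at h2
  obtain ⟨L, hL, hgL⟩ := (hg.prime.dvd_finsetProd_iff _).1 hf
  have hLg : Line.form L ∣ g := ((hg.associated_of_dvd (form_irreducible L)) hgL).symm.dvd
  obtain ⟨i, hi⟩ := Function.ne_iff.1 L.rep_nonzero
  have h1 : Line.form L ∣ pderiv i A.equation := hLg.trans (h i)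
  -- By the Leibniz rule the form of L would divide the product of the other forms, contradicting
  -- distinctness.
  rw [equation, ← Finset.mul_prod_erase _ _ hL, pderiv_mul, pderiv_form, add_comm] at h1
  have h2 := (dvd_add_right (Dvd.intro _ rfl)).1 h1
  have h3 := h2.mul_left (C (L.rep i)⁻¹)
  rw [← mul_assoc, ← C_mul, inv_mul_cancel₀ hi, C_1, one_mul] at h3
  obtain ⟨M, hM, hLM⟩ := ((form_irreducible L).prime.dvd_finsetProd_iff _).1 h3
  exact (Finset.mem_erase.1 hM).1 (eq_of_form_dvd_form hLM).symm

lemma gradient_ne_zero (hA : A.Nonempty) : (fun i => pderiv i A.equation) ≠ 0 := by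
  obtain ⟨L, -⟩ := id hA
  obtain ⟨i, hi⟩ := A.exists_not_dvd_pderiv_equation hA (form_irreducible L)
  exact fun h => hi (by rw [show pderiv i A.equation = 0 from congrFun h i]; exact dvd_zero _)

open Matrix in
/-- The cross product of two syzygies is a multiple of the gradient of the equation. -/
lemma exists_cross_eq_smul_gradient (hA : A.Nonempty) {σ τ : Fin 3 → S}
    (hσ : σ ∈ D0 A.equation) (hτ : τ ∈ D0 A.equation) :
    ∃ h : S, σ ⨯₃ τ = h • fun i => pderiv i A.equation :=
  exists_smul_of_primitive (A.gradient_ne_zero hA)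
    (fun _ hg => A.exists_not_dvd_pderiv_equation hA hg)
    (cross_mul_comm_of_dot_eq_zero hσ hτ)

open Matrix in
lemma cross_degree (hA : A.Nonempty) {σ τ : Fin 3 → S} {r s : ℕ}
    (hr : IsHomogeneousTriple σ r) (hs : IsHomogeneousTriple τ s)
    {h : S} (hne : σ ⨯₃ τ ≠ 0) (hh : σ ⨯₃ τ = h • fun i => pderiv i A.equation) :
    h ≠ 0 ∧ r + s = h.totalDegree + (A.card - 1) := by
  have hh0 : h ≠ 0 := by rintro rfl; exact hne (by rw [hh, zero_smul])
  obtain ⟨i, hi⟩ := Function.ne_iff.1 (A.gradient_ne_zero hA)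
  have hi' : pderiv i A.equation ≠ 0 := hi
  have hhom : ((σ ⨯₃ τ) i).IsHomogeneous (r + s) := by
    fin_cases i <;> simpa [cross_apply] using ((hr _).mul (hs _)).sub ((hr _).mul (hs _))
  have hval : (σ ⨯₃ τ) i = h * pderiv i A.equation := by rw [hh]; rfl
  have h1 := hhom.totalDegree (by rw [hval]; exact mul_ne_zero hh0 hi')
  rw [hval, totalDegree_mul_of_isDomain hh0 hi',
    (A.equation_isHomogeneous.pderiv).totalDegree hi'] at h1
  exact ⟨hh0, h1.symm⟩

open Matrix in
/-- Saito's criterion: two syzygies whose cross product is a nonzero constant multiple of the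
gradient are a basis. -/
lemma isFree_of_cross_eq (hA : A.Nonempty) {σ τ : Fin 3 → S}
    (hσ : σ ∈ D0 A.equation) (hτ : τ ∈ D0 A.equation) {c : ℂ} (hc : c ≠ 0)
    (h : σ ⨯₃ τ = (C c : S) • fun i => pderiv i A.equation) : A.IsFree := by
  have hne : σ ⨯₃ τ ≠ 0 := by
    rw [h]
    exact smul_ne_zero (by simpa using hc) (A.gradient_ne_zero hA)
  let b : Fin 2 → D0 A.equation := ![⟨σ, hσ⟩, ⟨τ, hτ⟩]
  have hli : LinearIndependent S b := by
    rw [LinearIndependent.pair_iff]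
    intro x y hxy
    have hxy' : x • σ + y • τ = 0 := congrArg Subtype.val hxy
    constructor
    · have := congrArg (fun v => v ⨯₃ τ) hxy'
      simpa [hne] using this
    · have := congrArg (fun v => σ ⨯₃ v) hxy'
      simpa [hne] using this
  have hsp : ⊤ ≤ Submodule.span S (Set.range b) := by
    rintro ⟨ω, hω⟩ -
    obtain ⟨u, hu⟩ := A.exists_cross_eq_smul_gradient hA hω hσ
    obtain ⟨v, hv⟩ := A.exists_cross_eq_smul_gradient hA hω hτ
    -- Cramer's rule: this difference is parallel to both σ and τ, hence zero.
    have hω' : (C c : S) • ω - (v • σ - u • τ) = 0 := by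
      refine eq_zero_of_cross_eq_zero hne ?_ ?_
      · simp only [map_sub, map_smul, LinearMap.sub_apply, LinearMap.smul_apply, cross_self, hu]
        rw [← cross_anticomm, h]
        module
      · simp only [map_sub, map_smul, LinearMap.sub_apply, LinearMap.smul_apply, cross_self, hv, h]
        module
    have hcc : (C c⁻¹ * C c : S) = 1 := by rw [← C_mul, inv_mul_cancel₀ hc, C_1]
    have : (⟨ω, hω⟩ : D0 A.equation) = (C c⁻¹ * v) • b 0 + (-(C c⁻¹ * u)) • b 1 := by
      refine Subtype.ext ?_
      change ω = (C c⁻¹ * v) • σ + (-(C c⁻¹ * u)) • τ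
      have h2 := congrArg (fun z => (C c⁻¹ : S) • z) (sub_eq_zero.1 hω')
      simp only [smul_smul, hcc, one_smul] at h2
      rw [h2]
      module
    rw [this]
    exact Submodule.add_mem _ (Submodule.smul_mem _ _ (Submodule.subset_span ⟨0, rfl⟩))
      (Submodule.smul_mem _ _ (Submodule.subset_span ⟨1, rfl⟩))
  exact Module.Free.of_basis (Module.Basis.mk hli hsp)

end Arrangement

/-! ### Syzygies coming from points. -/

/-- The derivative of `g` in the direction `v`. -/
noncomputable def dirDeriv (v : Fin 3 → ℂ) (g : S) : S := ∑ i, C (v i) * pderiv i g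

lemma dirDeriv_mul (v : Fin 3 → ℂ) (g h : S) :
    dirDeriv v (g * h) = dirDeriv v g * h + g * dirDeriv v h := by
  simp only [dirDeriv, Fin.sum_univ_three, pderiv_mul]
  ring

lemma dirDeriv_form (p : Plane) (L : Line) (h : Line.Through L p) :
    dirDeriv p.rep (Line.form L) = 0 := by
  rw [through_iff] at h
  simp only [dirDeriv, pderiv_form, ← C_mul, ← map_sum, h, C_0]

lemma dirDeriv_mul_X_isHomogeneous (v : Fin 3 → ℂ) {g : S} {r : ℕ} (hg : g.IsHomogeneous r)
    (i : Fin 3) : (dirDeriv v g * X i).IsHomogeneous r := by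
  cases r with
  | zero =>
    have : dirDeriv v g = 0 := by
      rw [totalDegree_eq_zero_iff_eq_C.1 (Nat.le_zero.1 hg.totalDegree_le)]
      simp [dirDeriv]
    rw [this, zero_mul]
    exact isHomogeneous_zero _ _ _
  | succ r =>
    refine IsHomogeneous.mul (IsHomogeneous.sum _ _ _ fun j _ => ?_) (isHomogeneous_X ℂ i)
    simpa using (isHomogeneous_C (Fin 3) (v j)).mul (hg.pderiv (i := j))

namespace Arrangement

variable (A : Arrangement)

open scoped Classical in
/-- The product of the forms of the lines which do not pass through `p`. -/
noncomputable def awayForm (p : Plane) : S :=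
  ∏ L ∈ A.filter fun L => ¬ Line.Through L p, Line.form L

lemma mult_le_card (p : Plane) : A.mult p ≤ A.card := by
  rw [mult]
  classical
  exact Finset.card_filter_le _ _

lemma awayForm_ne_zero (p : Plane) : A.awayForm p ≠ 0 := by
  rw [awayForm]
  exact Finset.prod_ne_zero_iff.2 fun L _ => form_ne_zero L

lemma awayForm_isHomogeneous (p : Plane) : (A.awayForm p).IsHomogeneous (A.card - A.mult p) := by
  classical
  have h := IsHomogeneous.prod (A.filter fun L => ¬ Line.Through L p) Line.form (fun _ => 1)
    fun L _ => form_isHomogeneous L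
  have hc := Finset.card_filter_add_card_filter_not (s := A) fun L => Line.Through L p
  have he : A.card - A.mult p = (A.filter fun L => ¬ Line.Through L p).card := by
    rw [mult]
    convert (Nat.eq_sub_of_add_eq' hc).symm
  rw [he]
  rw [Finset.sum_const, smul_eq_mul, mul_one] at h
  rw [awayForm]
  convert h

lemma exists_equation_eq (p : Plane) :
    ∃ g : S, dirDeriv p.rep g = 0 ∧ A.equation = g * A.awayForm p := by
  classical
  refine ⟨∏ L ∈ A.filter fun L => Line.Through L p, Line.form L, ?_, ?_⟩
  · refine Finset.prod_induction _ (fun g => dirDeriv p.rep g = 0) (fun a b ha hb => ?_) ?_ ?_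
    · rw [dirDeriv_mul, ha, hb, zero_mul, mul_zero, add_zero]
    · simp [dirDeriv]
    · exact fun L hL => dirDeriv_form p L (Finset.mem_filter.1 hL).2
  · rw [equation, awayForm, ← Finset.prod_filter_mul_prod_filter_not A fun L => Line.Through L p]

/-- The Jacobian syzygy given by the point `p`. -/
noncomputable def pointSyzygy (p : Plane) : Fin 3 → S := fun i =>
  C (A.card * p.rep i) * A.awayForm p - dirDeriv p.rep (A.awayForm p) * X i

lemma pointSyzygy_isHomogeneous (p : Plane) :
    IsHomogeneousTriple (A.pointSyzygy p) (A.card - A.mult p) := fun i => by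
  refine IsHomogeneous.sub ?_ (dirDeriv_mul_X_isHomogeneous _ (A.awayForm_isHomogeneous p) i)
  simpa using (isHomogeneous_C (Fin 3) (A.card * p.rep i)).mul (A.awayForm_isHomogeneous p)

lemma pointSyzygy_mem (p : Plane) : A.pointSyzygy p ∈ D0 A.equation := by
  obtain ⟨g, hg, hf⟩ := A.exists_equation_eq p
  have hE := A.equation_isHomogeneous.sum_X_mul_pderiv
  have hD : dirDeriv p.rep A.equation = g * dirDeriv p.rep (A.awayForm p) := by
    rw [hf, dirDeriv_mul, hg, zero_mul, zero_add]
  have hsum : ∑ i, A.pointSyzygy p i * pderiv i A.equation =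
      C (A.card : ℂ) * A.awayForm p * dirDeriv p.rep A.equation -
        dirDeriv p.rep (A.awayForm p) * ∑ i, X i * pderiv i A.equation := by
    simp only [pointSyzygy, Fin.sum_univ_three, C_mul]
    rw [show dirDeriv p.rep A.equation = _ from Fin.sum_univ_three _]
    ring
  rw [mem_D0, hsum, hE, hD, hf, nsmul_eq_mul, map_natCast]
  ring

-- A relation reads αp + βq = γ·(x,y,z). Pairing with p × q leaves γ times a nonzero linear form, so
-- γ = 0; then α = β = 0 since p and q are independent vectors.
open Matrix in
lemma pointSyzygy_independent (hA : A.Nonempty) {p q : Plane} (hpq : p ≠ q) {a b : S}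
    (h : a • A.pointSyzygy p + b • A.pointSyzygy q = 0) : a = 0 ∧ b = 0 := by
  have hc : p.rep ⨯₃ q.rep ≠ 0 := by
    rw [Ne, ← Projectivization.mk_eq_mk_iff_crossProduct_eq_zero p.rep_nonzero q.rep_nonzero,
      p.mk_rep, q.mk_rep]
    exact hpq
  set n := p.rep ⨯₃ q.rep with hn
  have hpn : ∑ i, n i * p.rep i = 0 := by
    simp [hn, cross_apply, Fin.sum_univ_three]; ring
  have hqn : ∑ i, n i * q.rep i = 0 := by
    simp [hn, cross_apply, Fin.sum_univ_three]; ring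
  have hlin : (∑ i, C (n i) * X i : S) ≠ 0 := by
    intro h0
    refine hc (funext fun i => ?_)
    have := congrArg (coeff (Finsupp.single i 1)) h0
    simpa [coeff_sum, coeff_C_mul, coeff_X, Finsupp.single_left_inj] using this
  set α := a * C (A.card : ℂ) * A.awayForm p with hα
  set β := b * C (A.card : ℂ) * A.awayForm q with hβ
  set γ := a * dirDeriv p.rep (A.awayForm p) + b * dirDeriv q.rep (A.awayForm q) with hγ
  have hi : ∀ i, α * C (p.rep i) + β * C (q.rep i) - γ * X i = 0 := fun i => by
    have := congrFun h i
    simp only [Pi.add_apply, Pi.smul_apply, smul_eq_mul, pointSyzygy, Pi.zero_apply, C_mul] at this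
    rw [← this, hα, hβ, hγ]
    ring
  have hγ0 : γ = 0 := by
    refine (mul_eq_zero.1 ?_).resolve_right hlin
    have e1 := congrArg (C : ℂ → S) hpn
    have e2 := congrArg (C : ℂ → S) hqn
    simp only [Fin.sum_univ_three, C_add, C_mul, C_0] at e1 e2 ⊢
    linear_combination α * e1 + β * e2 - C (n 0) * hi 0 - C (n 1) * hi 1 - C (n 2) * hi 2
  have hi' : ∀ i, α * C (p.rep i) + β * C (q.rep i) = 0 := fun i => by simpa [hγ0] using hi i
  have hex : ∃ i j, p.rep i * q.rep j - p.rep j * q.rep i ≠ 0 := by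
    by_contra! h0
    refine hc (funext fun l => ?_)
    fin_cases l <;> simp [hn, cross_apply, h0]
  obtain ⟨i, j, hij⟩ := hex
  have hij' : (C (p.rep i * q.rep j - p.rep j * q.rep i) : S) ≠ 0 := by
    rwa [Ne, C_eq_zero]
  have hα0 : α = 0 := by
    refine (mul_eq_zero.1 ?_).resolve_right hij'
    simp only [C_sub, C_mul]
    linear_combination C (q.rep j) * hi' i - C (q.rep i) * hi' j
  have hβ0 : β = 0 := by
    refine (mul_eq_zero.1 ?_).resolve_right hij'
    simp only [C_sub, C_mul]
    linear_combination C (p.rep i) * hi' j - C (p.rep j) * hi' i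
  constructor
  · simpa [hα, hA.ne_empty, A.awayForm_ne_zero] using hα0
  · simpa [hβ, hA.ne_empty, A.awayForm_ne_zero] using hβ0

lemma pointSyzygy_notMem_span_singleton (hA : A.Nonempty) {p q : Plane} (hpq : p ≠ q)
    (σ : Fin 3 → S) (hp : A.pointSyzygy p ∈ Submodule.span S {σ}) :
    A.pointSyzygy q ∉ Submodule.span S {σ} := by
  intro hq
  obtain ⟨a, ha⟩ := Submodule.mem_span_singleton.1 hp
  obtain ⟨b, hb⟩ := Submodule.mem_span_singleton.1 hq
  have h := A.pointSyzygy_independent hA hpq (a := b) (b := -a) (by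
    rw [← ha, ← hb]
    module)
  have ha0 : a = 0 := neg_eq_zero.1 h.2
  have h' := A.pointSyzygy_independent hA hpq (a := 1) (b := 0) (by
    rw [← ha, ha0]
    module)
  exact one_ne_zero h'.1

end Arrangement

end PlaneArrangement

/-! ### The inequalities for the exponents. -/

open PlaneArrangement in
theorem theorem4p6 (A : PlaneArrangement.Arrangement) (hA : A.Nonempty)
    (m n : ℕ) (hm : A.IsMaxMult m)
    (p : PlaneArrangement.Plane) (hp : A.mult p = m) (hn : A.IsMaxMultAway p n)
    (k : ℕ) (e : Fin k → ℕ) (he : A.IsExponents e) :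
    ∃ hk : 2 ≤ k, ∀ d d₁ d₂ t : ℤ,
      d = A.card → d₁ = e ⟨0, by omega⟩ → d₂ = e ⟨1, by omega⟩ → t = d₁ + d₂ - d + 1 →
      ((m : ℤ) - 1 ≤ t + m - 1 ∧ t + m - 1 ≤ d₂ ∧ d₂ ≤ d - n) ∧
      (d₂ = (m : ℤ) - 1 → A.IsFree ∧ d₁ = d - m) ∧
      (¬ A.IsFree → (m : ℤ) ≤ d₂) ∧
      (0 ≤ t ∧ t ≤ d + 1 - m - n) := by
  obtain ⟨q, ⟨hqA, hqp⟩, hqn⟩ := hn.1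
  have hpq : p ≠ q := fun h => hqp h.symm
  have hnm : n ≤ m := hm.2 ⟨q, hqA, hqn⟩
  obtain ⟨hmono, ρ, hmin, hρ⟩ := he
  have hspan : ∀ r : Plane, A.pointSyzygy r ∈
      Submodule.span S (ρ '' {j | e j ≤ A.card - A.mult r}) := fun r =>
    mem_span_of_isHomogeneousTriple hρ (hmin.1.symm ▸ A.pointSyzygy_mem r)
      (A.pointSyzygy_isHomogeneous r)
  have hle : ∀ (s : Set (Fin 3 → S)), s.Subsingleton →
      A.pointSyzygy p ∈ Submodule.span S s → A.pointSyzygy q ∉ Submodule.span S s := by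
    intro s hs h1 h2
    rcases hs.eq_empty_or_singleton with rfl | ⟨σ, rfl⟩
    · rw [Submodule.span_empty, ← Submodule.span_zero_singleton S] at h1 h2
      exact A.pointSyzygy_notMem_span_singleton hA hpq 0 h1 h2
    · exact A.pointSyzygy_notMem_span_singleton hA hpq σ h1 h2
  have hk : 2 ≤ k := by
    by_contra! hk
    have : Subsingleton (Fin k) := Fin.subsingleton_iff_le_one.2 (by omega)
    exact hle (Set.range ρ) (Set.subsingleton_range ρ) (hmin.1.symm ▸ A.pointSyzygy_mem p)
      (hmin.1.symm ▸ A.pointSyzygy_mem q)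
  refine ⟨hk, ?_⟩
  set i₀ : Fin k := ⟨0, by omega⟩ with hi₀
  set i₁ : Fin k := ⟨1, by omega⟩ with hi₁
  have hmd : m ≤ A.card := hp ▸ A.mult_le_card p
  have h1 : e i₀ ≤ A.card - m := by
    by_contra! hlt
    have hempty : {j | e j ≤ A.card - A.mult p} = ∅ := by
      ext j
      have : e i₀ ≤ e j := hmono (Fin.mk_le_of_le_val (Nat.zero_le _))
      simp only [Set.mem_ofPred_eq, Set.mem_empty_iff_false, iff_false, hp]
      omega
    have hp0 := hspan p
    rw [hempty, Set.image_empty, Submodule.span_empty, Submodule.mem_bot] at hp0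
    exact one_ne_zero (A.pointSyzygy_independent hA hpq (a := 1) (b := 0)
      (by rw [hp0]; module)).1
  have h2 : e i₁ ≤ A.card - n := by
    by_contra! hlt
    -- Both point syzygies have degree at most d - n, so they would be multiples of a single
    -- generator.
    have hsub : {j | e j ≤ A.card - n} ⊆ {i₀} := by
      intro j hj
      by_contra hne
      have h0 : j.val ≠ 0 := fun h => hne (Fin.ext h)
      have : e i₁ ≤ e j := hmono (Fin.mk_le_of_le_val (by omega))
      simp only [Set.mem_ofPred_eq] at hj
      omega
    have hs : (ρ '' {j | e j ≤ A.card - n}).Subsingleton :=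
      (Set.subsingleton_singleton.anti hsub).image ρ
    refine hle _ hs (Submodule.span_mono (Set.image_mono fun j hj => ?_) (hspan p))
      (hqn ▸ hspan q)
    simp only [Set.mem_ofPred_eq, hp] at hj ⊢
    omega
  have hnd : n ≤ A.card := hnm.trans hmd
  have hmem : ∀ j, ρ j ∈ D0 A.equation := fun j => hmin.1 ▸ Submodule.subset_span ⟨j, rfl⟩
  have hcross := cross_ne_zero_of_isMinimalGenerators (fun _ _ hb h => mem_D0_of_smul_mem hb h)
    hmin hρ (i := i₀) (j := i₁) (by simp [hi₀, hi₁])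
    fun l => hmono (Fin.mk_le_of_le_val (Nat.zero_le _))
  obtain ⟨h, hh⟩ := A.exists_cross_eq_smul_gradient hA (hmem i₀) (hmem i₁)
  obtain ⟨hh0, hdeg⟩ := A.cross_degree hA (hρ i₀) (hρ i₁) hcross hh
  have hd := hA.card_pos
  have hfree : e i₁ + 1 = m → A.IsFree := by
    intro hm1
    -- Here d₁ + d₂ ≤ (d - m) + (m - 1) = d - 1, so deg h = 0.
    obtain ⟨c, rfl⟩ : ∃ c, h = C c := ⟨_, totalDegree_eq_zero_iff_eq_C.1 (by omega)⟩
    exact A.isFree_of_cross_eq hA (hmem i₀) (hmem i₁) (by rintro rfl; simp at hh0) hh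
  rintro d d₁ d₂ t rfl rfl rfl rfl
  refine ⟨⟨by omega, by omega, by omega⟩, fun hm1 => ⟨hfree (by omega), by omega⟩,
    fun hnf => ?_, by omega, by omega⟩
  by_contra! hlt
  exact hnf (hfree (by omega))
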